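/- Work in the language of set theory, that is, first-order logic with equality and one binary predicate symbol $\in$; extensionality is not assumed. A formula is \emph{stratified} if natural numbers (types) can be assigned to its variables (a type for each free variable and for each variable bound by a quantifier, distinct quantifiers being taken to bind distinct variables) such that in each atomic subformula $x = y$ the variables $x$ and $y$ have the same type, and in each atomic subformula $x \in y$ the type of $y$ is the type of $x$ plus one. Stratified comprehension $SF$ is the theory whose axioms are the sentences $$\forall x_0 \cdots \forall x_{n-1}\, \exists X\, \forall y\, \bigl(y \in X \Leftrightarrow \varphi(x_0, \dots, x_{n-1}, y)\bigr)$$ for $n \ge 0$ and $\varphi$ a stratified formula with free variables among $x_0, \dots, x_{n-1}, y$ (so $X$ is not free in $\varphi$). Write $\mathrm{pair}(x,a,b)$ for $\forall y\,(y \in x \Leftrightarrow y = a \vee y = b)$. Claim: $SF$ is finitely axiomatized by the following five sentences. [1] Sheffer strokes: $\forall A, B\, \exists X\, \forall y\, (y \in X \Leftrightarrow \neg(y \in A \wedge y \in B))$. [2] Singletons: $\forall A\, \exists X\, \forall y\, (y \in X \Leftrightarrow y = A)$. [3] Set unions: $\forall A\, \exists X\, \forall y\, (y \in X \Leftrightarrow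 \exists k\, (k \in A \wedge y \in k))$. [4] Unordered relative products: $\forall R, S\, \exists X\, \forall y\, (y \in X \Leftrightarrow \exists a, b, c, r, s\, (\mathrm{pair}(y,a,c) \wedge r \in R \wedge s \in S \wedge \mathrm{pair}(r,a,b) \wedge \mathrm{pair}(s,b,c)))$. [5] Unordered intersection relation set: $\exists X\, \forall y\, (y \in X \Leftrightarrow \exists a, b, c\, (\mathrm{pair}(y,a,b) \wedge c \in a \wedge c \in b))$. That is, the theory consisting of [1]–[5] is finite, a structure $(M, \in)$ is a model of $SF$ if and only if it is a model of [1]–[5], and $SF$ and [1]–[5] have the same logical consequences. -/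

import Mathlib

open FirstOrder FirstOrder.Language

namespace SetTheorySF

/-- The only non-logical symbol of set theory: the binary predicate of membership. -/
inductive MemRel : ℕ → Type
  | mem : MemRel 2

/-- The first-order language FOL(=, ∈); equality is a logical symbol. -/
def LSet : FirstOrder.Language.{0, 0} := ⟨fun _ => Empty, MemRel⟩

/-- The membership symbol as a symbol of the language. -/
def memSymb : LSet.Relations 2 := MemRel.mem

/-- `E a b` says `a ∈ b` in the structure `M`. -/
def E {M : Type*} [LSet.Structure M] (a b : M) : Prop :=
  Structure.RelMap memSymb ![a, b]

/-! Stratification -/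

/-- The type of a term under an assignment of types to the free variables (`σ`) and to the
variables bound so far (`τ`). All terms of the language are variables. -/
def termType {α : Type} {n : ℕ} (σ : α → ℕ) (τ : Fin n → ℕ) : LSet.Term (α ⊕ Fin n) → ℕ
  | .var v => Sum.elim σ τ v
  | .func f _ => Empty.elim f

/-- The condition on the types of `x`, `y` in an atomic formula `x ∈ y`. -/
def relStratified : ∀ {l : ℕ}, MemRel l → (Fin l → ℕ) → Prop
  | _, .mem, t => t 1 = t 0 + 1

/-- The assignment `σ`, `τ` of types to the variables that are free in the formula can be
completed by a type for each bound variable, such that `x` and `y` have the same type in each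
atomic subformula `x = y`, and the type of `y` is the successor of the type of `x` in each atomic
subformula `x ∈ y`. Here each quantifier binds a variable of its own. -/
def StratifiedBy {α : Type} (σ : α → ℕ) :
    ∀ {n : ℕ}, (Fin n → ℕ) → LSet.BoundedFormula α n → Prop
  | _, _, .falsum => True
  | _, τ, .equal t₁ t₂ => termType σ τ t₁ = termType σ τ t₂
  | _, τ, .rel R ts => relStratified R (fun i => termType σ τ (ts i))
  | _, τ, .imp φ ψ => StratifiedBy σ τ φ ∧ StratifiedBy σ τ ψ
  | _, τ, .all φ => ∃ k : ℕ, StratifiedBy σ (Fin.snoc τ k) φ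

/-- A formula is stratified if some assignment of types stratifies it. -/
def Stratified {α : Type} (φ : LSet.Formula α) : Prop :=
  ∃ σ : α → ℕ, StratifiedBy σ (Fin.elim0 : Fin 0 → ℕ) φ

/-! Formulas of the language; `&i` is the variable that the `i`-th quantifier from outside binds -/

/-- The formula `xᵢ ∈ xⱼ`. -/
def memF {n : ℕ} (i j : Fin n) : LSet.BoundedFormula Empty n :=
  .rel memSymb ![&i, &j]

/-- The formula `xᵢ = xⱼ`. -/
def eqF {n : ℕ} (i j : Fin n) : LSet.BoundedFormula Empty n :=
  .equal (&i) (&j)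

/-- The formula `pair(x, a, b)`, that is, `∀ y, y ∈ x ↔ y = a ∨ y = b`. -/
def pairF {n : ℕ} (x a b : Fin n) : LSet.BoundedFormula Empty n :=
  ∀' (memF (Fin.last n) x.castSucc ⇔
    (eqF (Fin.last n) a.castSucc ⊔ eqF (Fin.last n) b.castSucc))

/-- The instance `∀ x₀ … xₙ₋₁ ∃ X ∀ y (y ∈ X ↔ φ(x₀, …, xₙ₋₁, y))` of comprehension for a
formula `φ` with free variables `x₀, …, xₙ₋₁, y`. In the prefix `X` is variable number `n` and
`y` is variable number `n + 1`; so the variables of `φ` are renumbered to skip `X`. -/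
def comprehension {n : ℕ} (φ : LSet.Formula (Fin (n + 1))) : LSet.Sentence :=
  BoundedFormula.alls (n := n) (∃' ∀' (memF (Fin.last (n + 1)) (Fin.last n).castSucc ⇔
    (BoundedFormula.relabel (n := n + 2) (k := 0)
      (fun i => (Sum.inr ((Fin.last n).castSucc.succAbove i) : Empty ⊕ Fin (n + 2))) φ :
        LSet.BoundedFormula Empty (n + 2))))

/-- Stratified comprehension: all instances of comprehension for stratified formulas. -/
def SF : LSet.Theory :=
  {ψ | ∃ (n : ℕ) (φ : LSet.Formula (Fin (n + 1))), Stratified φ ∧ ψ = comprehension φ}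

/-! The five axioms -/

/-- `∀ A B ∃ X ∀ y (y ∈ X ↔ ¬ (y ∈ A ∧ y ∈ B))`; variables `A, B, X, y = 0, 1, 2, 3`. -/
def shefferStrokes : LSet.Sentence :=
  ∀' ∀' ∃' ∀' ((memF 3 2 : LSet.BoundedFormula Empty 4) ⇔ ∼(memF 3 0 ⊓ memF 3 1))

/-- `∀ A ∃ X ∀ y (y ∈ X ↔ y = A)`; variables `A, X, y = 0, 1, 2`. -/
def singletons : LSet.Sentence :=
  ∀' ∃' ∀' ((memF 2 1 : LSet.BoundedFormula Empty 3) ⇔ eqF 2 0)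

/-- `∀ A ∃ X ∀ y (y ∈ X ↔ ∃ k (k ∈ A ∧ y ∈ k))`; variables `A, X, y, k = 0, 1, 2, 3`. -/
def setUnions : LSet.Sentence :=
  ∀' ∃' ∀' ((memF 2 1 : LSet.BoundedFormula Empty 3) ⇔
    ∃' ((memF 3 0 : LSet.BoundedFormula Empty 4) ⊓ memF 2 3))

/-- `∀ R S ∃ X ∀ y (y ∈ X ↔ ∃ a b c r s
(pair(y, a, c) ∧ r ∈ R ∧ s ∈ S ∧ pair(r, a, b) ∧ pair(s, b, c)))`;
variables `R, S, X, y, a, b, c, r, s = 0, 1, 2, 3, 4, 5, 6, 7, 8`. -/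
def unorderedRelativeProducts : LSet.Sentence :=
  ∀' ∀' ∃' ∀' ((memF 3 2 : LSet.BoundedFormula Empty 4) ⇔
    ∃' ∃' ∃' ∃' ∃' ((pairF 3 4 6 : LSet.BoundedFormula Empty 9) ⊓
      (memF 7 0 ⊓ (memF 8 1 ⊓ (pairF 7 4 5 ⊓ pairF 8 5 6)))))

/-- `∃ X ∀ y (y ∈ X ↔ ∃ a b c (pair(y, a, b) ∧ c ∈ a ∧ c ∈ b))`;
variables `X, y, a, b, c = 0, 1, 2, 3, 4`. -/
def unorderedIntersectionRelation : LSet.Sentence :=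
  ∃' ∀' ((memF 1 0 : LSet.BoundedFormula Empty 2) ⇔
    ∃' ∃' ∃' ((pairF 1 2 3 : LSet.BoundedFormula Empty 5) ⊓ (memF 4 2 ⊓ memF 4 3)))

/-- The theory with the five axioms. -/
def fiveAxioms : LSet.Theory :=
  {shefferStrokes, singletons, setUnions, unorderedRelativeProducts,
    unorderedIntersectionRelation}

/-! The meaning of these sentences in a structure -/

section Meaning

variable {M : Type*} [LSet.Structure M]

theorem realize_memF {n : ℕ} (i j : Fin n) (v : Empty → M) (w : Fin n → M) :
    (memF i j).Realize v w ↔ E (w i) (w j) := by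
  unfold memF E
  have h : (fun k => Term.realize (Sum.elim v w)
      ((![&i, &j] : Fin 2 → LSet.Term (Empty ⊕ Fin n)) k)) = ![w i, w j] := by
    funext k
    fin_cases k <;> simp
  exact iff_of_eq (congrArg _ h)

theorem realize_eqF {n : ℕ} (i j : Fin n) (v : Empty → M) (w : Fin n → M) :
    (eqF i j).Realize v w ↔ w i = w j := by
  simp [eqF, BoundedFormula.Realize]

/-- `IsPair x a b` says that `x` is an unordered pair of `a` and `b`. -/
def IsPair (x a b : M) : Prop := ∀ y, E y x ↔ y = a ∨ y = b

theorem realize_pairF {n : ℕ} (x a b : Fin n) (v : Empty → M) (w : Fin n → M) :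
    (pairF x a b).Realize v w ↔ IsPair (w x) (w a) (w b) := by
  simp [pairF, IsPair, realize_memF, realize_eqF]

theorem realize_comprehension {n : ℕ} (φ : LSet.Formula (Fin (n + 1))) :
    M ⊨ comprehension φ ↔
      ∀ p : Fin n → M, ∃ X : M, ∀ y : M, E y X ↔ φ.Realize (Fin.snoc p y : Fin (n + 1) → M) := by
  unfold comprehension Sentence.Realize
  rw [BoundedFormula.realize_alls]
  refine forall_congr' fun p => ?_
  rw [BoundedFormula.realize_ex]
  refine exists_congr fun X => ?_
  rw [BoundedFormula.realize_all]
  refine forall_congr' fun y => ?_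
  rw [BoundedFormula.realize_iff, realize_memF, BoundedFormula.realize_relabel]
  have h₁ : (Fin.snoc (Fin.snoc p X : Fin (n + 1) → M) y : Fin (n + 2) → M)
      (Fin.last (n + 1)) = y := Fin.snoc_last _ _
  have h₂ : (Fin.snoc (Fin.snoc p X : Fin (n + 1) → M) y : Fin (n + 2) → M)
      (Fin.last n).castSucc = X := by rw [Fin.snoc_castSucc, Fin.snoc_last]
  have h₃ : ∀ i : Fin (n + 1), (Fin.snoc (Fin.snoc p X : Fin (n + 1) → M) y : Fin (n + 2) → M)
      ((Fin.last n).castSucc.succAbove i) = (Fin.snoc p y : Fin (n + 1) → M) i := by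
    intro i
    refine Fin.lastCases ?_ (fun j => ?_) i
    · rw [Fin.succAbove_castSucc_self, Fin.succ_last, Fin.snoc_last, Fin.snoc_last]
    · rw [Fin.succAbove_of_castSucc_lt _ _ (by simp [Fin.lt_def]), Fin.snoc_castSucc,
        Fin.snoc_castSucc, Fin.snoc_castSucc]
  rw [h₁, h₂, Formula.Realize]
  refine iff_congr Iff.rfl (iff_of_eq ?_)
  congr 1
  · funext i
    exact h₃ i
  · exact Subsingleton.elim _ _

theorem realize_shefferStrokes :
    M ⊨ shefferStrokes ↔ ∀ A B : M, ∃ X, ∀ y, E y X ↔ ¬ (E y A ∧ E y B) := by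
  simp [shefferStrokes, Sentence.Realize, Formula.Realize, realize_memF, Fin.snoc]

theorem realize_singletons :
    M ⊨ singletons ↔ ∀ A : M, ∃ X, ∀ y, E y X ↔ y = A := by
  simp [singletons, Sentence.Realize, Formula.Realize, realize_memF, realize_eqF, Fin.snoc]

theorem realize_setUnions :
    M ⊨ setUnions ↔ ∀ A : M, ∃ X, ∀ y, E y X ↔ ∃ k, E k A ∧ E y k := by
  simp [setUnions, Sentence.Realize, Formula.Realize, realize_memF, Fin.snoc]

theorem realize_unorderedRelativeProducts :
    M ⊨ unorderedRelativeProducts ↔ ∀ R S : M, ∃ X, ∀ y, E y X ↔ ∃ a b c r s,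
      IsPair y a c ∧ E r R ∧ E s S ∧ IsPair r a b ∧ IsPair s b c := by
  simp [unorderedRelativeProducts, Sentence.Realize, Formula.Realize, realize_memF,
    realize_pairF, Fin.snoc]

theorem realize_unorderedIntersectionRelation :
    M ⊨ unorderedIntersectionRelation ↔ ∃ X : M, ∀ y, E y X ↔ ∃ a b c,
      IsPair y a b ∧ E c a ∧ E c b := by
  simp [unorderedIntersectionRelation, Sentence.Realize, Formula.Realize, realize_memF,
    realize_pairF, Fin.snoc]

end Meaning

end SetTheorySF

/-! Each of the five axioms is itself a stratified instance of comprehension, so the content is the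
converse. Call a class a set if it is the extension of an object, and a symmetric relation a set
relation if its unordered pairs form a set. The axioms make the sets a Boolean algebra closed under
unions, and the set relations closed under Boolean operations and symmetrised composition, starting
from "having a common element". Composition plays the role of quantification. It yields agreement on
a set (`IsSet.isRel_inter_eq`), the set of all singletons (`isSet_singles`) and the transfer of a
relation to singletons (`IsRel.lift`).

An assignment is coded by one object. Each variable has a tag that is not a singleton, and a value
of type `k` is entered as the pair of the tag and its `(T - k + 1)`-fold singleton. Stratification
brings all values to a common level, so that membership between adjacent types becomes a set
relation `liftedMem`. By induction on the formula (`exists_isSet_codes`) a set separates the codes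
of satisfying assignments from the other codes: atoms come from `IsRel.exists_slots`, connectives
from Boolean operations, quantifiers from closing a set of codes under changes in one slot. Fixing
the parameters and decoding by unions gives comprehension (`isSet_of_stratified`). Only extensions
are ever compared, so extensionality plays no role. -/

namespace SetTheorySF

/-! ### Closure properties of sets and of symmetric set relations. -/

section SetClosure

variable {M : Type*} [LSet.Structure M]

/-- The extension of an object, as a set in the metatheory. -/
def ext (x : M) : Set M := {y | E y x}

/-- A subclass of the structure is a set if it is the extension of some object. -/
def IsSet (A : Set M) : Prop := ∃ x, ext x = A

theorem mem_ext {x y : M} : y ∈ ext x ↔ E y x := Iff.rfl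

theorem isPair_iff {x a b : M} : IsPair x a b ↔ ext x = {a, b} := by
  simp [IsPair, Set.ext_iff, mem_ext]

theorem isSet_iff {P : M → Prop} : IsSet {y | P y} ↔ ∃ X : M, ∀ y, E y X ↔ P y := by
  simp [IsSet, Set.ext_iff, mem_ext]

variable (M) in
/-- The five axioms, in terms of extensions. -/
class FiveModel : Prop where
  sheffer : ∀ A B : M, IsSet (ext A ∩ ext B)ᶜ
  singleton : ∀ a : M, IsSet {a}
  sUnion : ∀ A : M, IsSet {y : M | ∃ k ∈ ext A, y ∈ ext k}
  product : ∀ R S : M, IsSet {y : M | ∃ a b c, ext y = {a, c} ∧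
    (∃ r ∈ ext R, ext r = {a, b}) ∧ ∃ s ∈ ext S, ext s = {b, c}}
  inter : IsSet {y : M | ∃ a b, ext y = {a, b} ∧ (ext a ∩ ext b).Nonempty}

/-- A symmetric relation is a set relation if its unordered pairs form a set. -/
structure IsRel (ρ : M → M → Prop) : Prop where
  symm : ∀ a b, ρ a b → ρ b a
  isSet : IsSet {y : M | ∃ a b, ext y = {a, b} ∧ ρ a b}

theorem IsRel.congr {ρ σ : M → M → Prop} (h : IsRel ρ) (e : ∀ a b, ρ a b ↔ σ a b) :
    IsRel σ := by
  have : ρ = σ := by funext a b; exact propext (e a b)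
  exact this ▸ h

theorem IsSet.congr {A B : Set M} (h : IsSet A) (e : ∀ y, y ∈ A ↔ y ∈ B) : IsSet B :=
  Set.ext e ▸ h

/-- Membership of a pair in the set of pairs of a set relation. -/
theorem IsRel.pair_iff {ρ : M → M → Prop} (hρ : IsRel ρ) {y a b : M} (hy : ext y = {a, b}) :
    (∃ a b, ext y = {a, b} ∧ ρ a b) ↔ ρ a b := by
  constructor
  · rintro ⟨c, d, h, hcd⟩
    rw [hy, Set.pair_eq_pair_iff] at h
    rcases h with ⟨rfl, rfl⟩ | ⟨rfl, rfl⟩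
    · exact hcd
    · exact hρ.symm _ _ hcd
  · exact fun h => ⟨a, b, hy, h⟩

variable [FiveModel M]

theorem IsSet.compl {A : Set M} (hA : IsSet A) : IsSet Aᶜ := by
  obtain ⟨a, rfl⟩ := hA
  simpa using FiveModel.sheffer a a

theorem IsSet.inter {A B : Set M} (hA : IsSet A) (hB : IsSet B) : IsSet (A ∩ B) := by
  obtain ⟨a, rfl⟩ := hA
  obtain ⟨b, rfl⟩ := hB
  simpa using (FiveModel.sheffer a b).compl

theorem IsSet.union {A B : Set M} (hA : IsSet A) (hB : IsSet B) : IsSet (A ∪ B) := by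
  simpa [Set.compl_inter] using (hA.compl.inter hB.compl).compl

theorem IsSet.sdiff {A B : Set M} (hA : IsSet A) (hB : IsSet B) : IsSet (A \ B) :=
  hA.inter hB.compl

theorem isSet_singleton (a : M) : IsSet {a} := FiveModel.singleton a

theorem isSet_pair (a b : M) : IsSet {a, b} :=
  (isSet_singleton a).union (isSet_singleton b)

variable (M) in
theorem isSet_empty : IsSet (∅ : Set M) := by
  -- This axiom has no parameters, so it also shows that the structure is nonempty.
  obtain ⟨x, -⟩ := FiveModel.inter (M := M)
  have h := isSet_singleton x
  simpa using h.inter h.compl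

variable (M) in
theorem isSet_univ : IsSet (Set.univ : Set M) := by
  simpa using (isSet_empty M).compl

theorem IsSet.sUnion {A : Set M} (hA : IsSet A) : IsSet {y | ∃ k ∈ A, y ∈ ext k} := by
  obtain ⟨a, rfl⟩ := hA
  exact FiveModel.sUnion a

theorem isSet_range {ι : Type*} [Finite ι] (f : ι → M) : IsSet (Set.range f) := by
  have h : ∀ s : Set M, s.Finite → IsSet s := by
    intro s hs
    induction s, hs using Set.Finite.induction_on with
    | empty => exact isSet_empty M
    | insert _ _ ih => exact (isSet_singleton _).union ih
  exact h _ (Set.finite_range f)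

theorem IsRel.exists_pair_iff {ρ : M → M → Prop} (hρ : IsRel ρ) {R : M}
    (hR : ext R = {y : M | ∃ a b, ext y = {a, b} ∧ ρ a b}) {a b : M} :
    (∃ r ∈ ext R, ext r = {a, b}) ↔ ρ a b := by
  rw [hR]
  constructor
  · rintro ⟨r, hr, e⟩
    exact (hρ.pair_iff e).1 hr
  · intro h
    obtain ⟨r, hr⟩ := isSet_pair a b
    exact ⟨r, ⟨a, b, hr, h⟩, hr⟩

/-- Unordered pairs carry no direction, so relative products give only the symmetrised composition.
Applications must make the reversed disjunct harmless. -/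
theorem IsRel.comp {ρ σ : M → M → Prop} (hρ : IsRel ρ) (hσ : IsRel σ) :
    IsRel fun a c => (∃ b, ρ a b ∧ σ b c) ∨ ∃ b, σ a b ∧ ρ b c := by
  refine ⟨?_, ?_⟩
  · rintro a c (⟨b, h, k⟩ | ⟨b, h, k⟩)
    · exact Or.inr ⟨b, hσ.symm _ _ k, hρ.symm _ _ h⟩
    · exact Or.inl ⟨b, hρ.symm _ _ k, hσ.symm _ _ h⟩
  · obtain ⟨R, hR⟩ := hρ.isSet
    obtain ⟨S, hS⟩ := hσ.isSet
    refine (FiveModel.product R S).congr fun y => ?_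
    simp only [hρ.exists_pair_iff hR, hσ.exists_pair_iff hS, Set.mem_ofPred_eq]
    constructor
    · rintro ⟨a, b, c, e, h, k⟩
      exact ⟨a, c, e, Or.inl ⟨b, h, k⟩⟩
    · rintro ⟨a, c, e, ⟨b, h, k⟩ | ⟨b, h, k⟩⟩
      · exact ⟨a, b, c, e, h, k⟩
      · exact ⟨c, b, a, by rw [e, Set.pair_comm], hρ.symm _ _ k, hσ.symm _ _ h⟩

/-- `a` and `b` have a common element. -/
def Meet (a b : M) : Prop := (ext a ∩ ext b).Nonempty

variable (M) in
theorem isRel_meet : IsRel (Meet : M → M → Prop) :=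
  ⟨fun a b h => by unfold Meet at *; rwa [Set.inter_comm], FiveModel.inter⟩

variable (M) in
theorem isRel_true : IsRel fun _ _ : M => True := by
  refine ⟨fun _ _ _ => trivial, ?_⟩
  obtain ⟨V, hV⟩ := isSet_univ M
  refine (FiveModel.product V V).congr fun y => ?_
  simp only [hV, Set.mem_univ, true_and, Set.mem_ofPred_eq, and_true]
  constructor
  · rintro ⟨a, b, c, e, -⟩
    exact ⟨a, c, e⟩
  · rintro ⟨a, c, e⟩
    exact ⟨a, a, c, e, isSet_pair a a, isSet_pair a c⟩

theorem IsRel.and {ρ σ : M → M → Prop} (hρ : IsRel ρ) (hσ : IsRel σ) :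
    IsRel fun a b => ρ a b ∧ σ a b := by
  refine ⟨fun a b h => ⟨hρ.symm _ _ h.1, hσ.symm _ _ h.2⟩, (hρ.isSet.inter hσ.isSet).congr ?_⟩
  intro y
  constructor
  · rintro ⟨⟨a, b, e, h⟩, k⟩
    exact ⟨a, b, e, h, (hσ.pair_iff e).1 k⟩
  · rintro ⟨a, b, e, h, k⟩
    exact ⟨⟨a, b, e, h⟩, a, b, e, k⟩

theorem IsRel.not {ρ : M → M → Prop} (hρ : IsRel ρ) : IsRel fun a b => ¬ ρ a b := by
  refine ⟨fun a b h k => h (hρ.symm _ _ k), ((isRel_true M).isSet.sdiff hρ.isSet).congr ?_⟩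
  intro y
  constructor
  · rintro ⟨⟨a, b, e, -⟩, k⟩
    exact ⟨a, b, e, fun h => k ⟨a, b, e, h⟩⟩
  · rintro ⟨a, b, e, h⟩
    exact ⟨⟨a, b, e, trivial⟩, fun k => h ((hρ.pair_iff e).1 k)⟩

theorem IsRel.or {ρ σ : M → M → Prop} (hρ : IsRel ρ) (hσ : IsRel σ) :
    IsRel fun a b => ρ a b ∨ σ a b :=
  (hρ.not.and hσ.not).not.congr fun a b => by tauto

theorem IsRel.field {ρ : M → M → Prop} (hρ : IsRel ρ) : IsSet {a | ∃ b, ρ a b} := by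
  refine hρ.isSet.sUnion.congr fun z => ?_
  constructor
  · rintro ⟨y, ⟨a, b, e, h⟩, hz⟩
    rw [e] at hz
    rcases hz with rfl | rfl
    · exact ⟨b, h⟩
    · exact ⟨a, hρ.symm _ _ h⟩
  · rintro ⟨b, h⟩
    obtain ⟨y, hy⟩ := isSet_pair z b
    exact ⟨y, ⟨z, b, hy, h⟩, by simp [hy]⟩

/-- The product of the single pair `{b, b}` with `Meet` consists of the pairs `{b, c}` with `c`
meeting `b`. Their union also contains `b`, but only when `b` is nonempty and hence meets itself. -/
theorem IsSet.meets {B : Set M} (hB : IsSet B) : IsSet {c : M | (ext c ∩ B).Nonempty} := by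
  obtain ⟨b, rfl⟩ := hB
  obtain ⟨r, hr⟩ := isSet_singleton b
  obtain ⟨R, hR⟩ := isSet_singleton r
  obtain ⟨S, hS⟩ := (isRel_meet M).isSet
  refine (FiveModel.product R S).sUnion.congr fun z => ?_
  simp only [(isRel_meet M).exists_pair_iff hS, hR, Set.mem_ofPred_eq, Set.mem_singleton_iff,
    exists_eq_left, hr, Meet]
  constructor
  · rintro ⟨y, ⟨a, b', c, e, h, k⟩, hz⟩
    have h1 : a ∈ ({b} : Set M) := h ▸ Set.mem_insert _ _
    have h2 : b' ∈ ({b} : Set M) := h ▸ Set.mem_insert_of_mem _ rfl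
    obtain rfl : a = b := h1
    obtain rfl : b' = a := h2
    rw [e] at hz
    rcases hz with rfl | rfl
    · obtain ⟨u, hu, -⟩ := k
      exact ⟨u, hu, hu⟩
    · rwa [Set.inter_comm]
  · intro h
    obtain ⟨y, hy⟩ := isSet_pair b z
    exact ⟨y, ⟨b, b, z, hy, by simp, by rwa [Set.inter_comm]⟩, by simp [hy]⟩

theorem IsSet.powerset {B : Set M} (hB : IsSet B) : IsSet {c : M | ext c ⊆ B} := by
  refine hB.compl.meets.compl.congr fun z => ?_
  simp [Set.not_nonempty_iff_eq_empty, ← Set.disjoint_iff_inter_eq_empty,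
    Set.disjoint_compl_right_iff_subset]

theorem IsSet.box {A : Set M} (hA : IsSet A) : IsRel fun a b => a ∈ A ∧ b ∈ A := by
  refine ⟨fun a b h => h.symm, ((isRel_true M).isSet.inter hA.powerset).congr fun y => ?_⟩
  constructor
  · rintro ⟨⟨a, b, e, -⟩, k⟩
    refine ⟨a, b, e, ?_, ?_⟩ <;> apply k <;> simp [e]
  · rintro ⟨a, b, e, h, k⟩
    refine ⟨⟨a, b, e, trivial⟩, ?_⟩
    simp [e, Set.insert_subset_iff, h, k]

theorem IsSet.cobox {A : Set M} (hA : IsSet A) : IsRel fun a b => a ∈ A ∨ b ∈ A :=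
  hA.compl.box.not.congr fun a b => by simp only [Set.mem_compl_iff]; tauto

theorem IsSet.cross {A B : Set M} (hA : IsSet A) (hB : IsSet B) (hAB : Disjoint A B) :
    IsRel fun a b => (a ∈ A ∧ b ∈ B) ∨ (a ∈ B ∧ b ∈ A) := by
  refine ((hA.union hB).box.and (hA.cobox.and hB.cobox)).congr fun a b => ?_
  have h1 : a ∈ A → a ∉ B := fun h k => Set.disjoint_left.1 hAB h k
  have h2 : b ∈ A → b ∉ B := fun h k => Set.disjoint_left.1 hAB h k
  simp only [Set.mem_union]
  tauto

/-- Compose `ε` with its restriction to `A`. The reversed disjunct puts `s` itself into `A`, which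
is harmless by reflexivity. -/
theorem IsRel.image {ε : M → M → Prop} (hε : IsRel ε) (refl : ∀ a, ε a a) {A : Set M}
    (hA : IsSet A) : IsSet {s | ∃ a ∈ A, ε s a} := by
  refine (hε.comp (hε.and hA.box)).field.congr fun s => ?_
  constructor
  · rintro ⟨s', ⟨b, h, -, k, -⟩ | ⟨b, ⟨-, h, -⟩, -⟩⟩
    · exact ⟨b, k, h⟩
    · exact ⟨s, h, refl s⟩
  · rintro ⟨a, ha, h⟩
    exact ⟨a, Or.inl ⟨a, h, refl a, ha, ha⟩⟩

/-- The relation of having the same elements in `B`. -/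
theorem IsSet.isRel_inter_eq {B : Set M} (hB : IsSet B) :
    IsRel fun s t => ext s ∩ B = ext t ∩ B := by
  -- That `s ∩ B` is not included in `t` is witnessed by some `z` meeting `s` but not `t`, namely a
  -- singleton inside `B`. The symmetric condition "one of the two is a subset of `B`" forces the
  -- common element of `s` and `z` into `B`. The two disjuncts of the composition refute the two
  -- inclusions.
  refine (((isRel_meet M).and hB.powerset.cobox).comp
    ((isRel_meet M).not.and hB.powerset.cobox)).not.congr fun s t => ?_
  have key : ∀ s t : M, (∃ z, (Meet s z ∧ (s ∈ {c : M | ext c ⊆ B} ∨ z ∈ {c : M | ext c ⊆ B})) ∧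
      (¬ Meet z t ∧ (z ∈ {c : M | ext c ⊆ B} ∨ t ∈ {c : M | ext c ⊆ B}))) ↔
      ¬ ext s ∩ B ⊆ ext t := by
    intro s t
    constructor
    · rintro ⟨z, ⟨⟨u, hus, huz⟩, h1⟩, h2, -⟩ hst
      have : u ∈ B := by
        rcases h1 with h1 | h1
        · exact h1 hus
        · exact h1 huz
      exact h2 ⟨u, huz, hst ⟨hus, this⟩⟩
    · intro h
      obtain ⟨u, ⟨hus, huB⟩, hut⟩ := Set.not_subset.1 h
      obtain ⟨z, hz⟩ := isSet_singleton u
      have hzB : ext z ⊆ B := by simpa [hz] using huB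
      refine ⟨z, ⟨⟨u, hus, by simp [hz]⟩, Or.inr hzB⟩, ?_, Or.inl hzB⟩
      rintro ⟨x, hx, hxt⟩
      rw [hz] at hx
      exact hut (hx ▸ hxt)
  have key' : (∃ z, (¬ Meet s z ∧ (s ∈ {c : M | ext c ⊆ B} ∨ z ∈ {c : M | ext c ⊆ B})) ∧
      (Meet z t ∧ (z ∈ {c : M | ext c ⊆ B} ∨ t ∈ {c : M | ext c ⊆ B}))) ↔
      ¬ ext t ∩ B ⊆ ext s := by
    rw [← key t s]
    refine exists_congr fun z => ?_
    have h1 : Meet s z ↔ Meet z s := ⟨(isRel_meet M).symm _ _, (isRel_meet M).symm _ _⟩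
    have h2 : Meet z t ↔ Meet t z := ⟨(isRel_meet M).symm _ _, (isRel_meet M).symm _ _⟩
    rw [h1, h2]
    tauto
  rw [key s t, key', not_or, not_not, not_not]
  constructor
  · rintro ⟨h, k⟩
    exact Set.Subset.antisymm (fun x hx => ⟨h hx, hx.2⟩) (fun x hx => ⟨k hx, hx.2⟩)
  · intro h
    exact ⟨h ▸ Set.inter_subset_left, h ▸ Set.inter_subset_left⟩

/-- Closing `A` under arbitrary changes outside `B` serves below as existential quantification. -/
theorem IsSet.saturate {A B : Set M} (hA : IsSet A) (hB : IsSet B) :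
    IsSet {s : M | ∃ a ∈ A, ext s ∩ B = ext a ∩ B} :=
  hB.isRel_inter_eq.image (fun _ => rfl) hA

variable (M) in
theorem isRel_coext : IsRel fun s t : M => ext s = ext t :=
  (isSet_univ M).isRel_inter_eq.congr fun s t => by simp

-- The map to singletons is injective and misses the empty set.
variable (M) in
theorem infinite_of_fiveModel : Infinite M := by
  choose f hf using isSet_singleton (M := M)
  have inj : Function.Injective f := fun a b h => by
    have := (hf a).symm.trans ((congrArg ext h).trans (hf b))
    simpa using this
  refine not_finite_iff_infinite.1 fun _ => ?_
  obtain ⟨e, he⟩ := isSet_empty M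
  obtain ⟨a, rfl⟩ := (Finite.injective_iff_surjective.1 inj) e
  rw [hf] at he
  simp at he

/-- The relation of complementarity, between nontrivial classes. -/
theorem isRel_compl : IsRel fun a b : M =>
    ((ext a).Nonempty ∧ (ext b).Nonempty) ∧ ext b = (ext a)ᶜ := by
  have hN : IsSet {c : M | (ext c).Nonempty} := by
    simpa using (isSet_univ M).meets
  have hD := (isRel_meet M).not.and hN.box
  -- Disjoint `a` and `b` are complementary iff no nonempty `z` misses both; the singleton of an
  -- uncovered point would be such a `z`.
  refine (hD.and (hD.comp hD).not).congr fun a b => ?_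
  constructor
  · rintro ⟨⟨h1, h2⟩, h3⟩
    refine ⟨h2, Set.Subset.antisymm (fun x hx hxa => h1 ⟨x, hxa, hx⟩) fun x hxa => ?_⟩
    by_contra hxb
    obtain ⟨z, hz⟩ := isSet_singleton x
    have hzn : (ext z).Nonempty := by simp [hz]
    refine h3 (Or.inl ⟨z, ⟨?_, h2.1, hzn⟩, ?_, hzn, h2.2⟩)
    · rintro ⟨y, hy, hyz⟩
      rw [hz] at hyz
      exact hxa (hyz ▸ hy)
    · rintro ⟨y, hyz, hy⟩
      rw [hz] at hyz
      exact hxb (hyz ▸ hy)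
  · rintro ⟨h, e⟩
    refine ⟨⟨?_, h⟩, ?_⟩
    · rintro ⟨x, hxa, hxb⟩
      rw [e] at hxb
      exact hxb hxa
    · have : ¬ ∃ z, (¬ Meet a z ∧ (ext a).Nonempty ∧ (ext z).Nonempty) ∧
          (¬ Meet z b ∧ (ext z).Nonempty ∧ (ext b).Nonempty) := by
        rintro ⟨z, ⟨h1, -, ⟨x, hx⟩⟩, h2, -⟩
        by_cases hxa : x ∈ ext a
        · exact h1 ⟨x, hxa, hx⟩
        · exact h2 ⟨x, hx, by rw [e]; exact hxa⟩
      rintro (h | h) <;> exact this h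

theorem isSet_nontrivial : IsSet {a : M | (ext a).Nonempty ∧ (ext a)ᶜ.Nonempty} := by
  refine (isRel_compl (M := M)).field.congr fun a => ?_
  constructor
  · rintro ⟨b, ⟨h, k⟩, e⟩
    exact ⟨h, e ▸ k⟩
  · rintro ⟨h, k⟩
    obtain ⟨b, hb⟩ := IsSet.compl ⟨a, rfl⟩
    exact ⟨b, ⟨h, hb ▸ k⟩, hb⟩

variable (M) in
/-- The class of all singletons. -/
def singles : Set M := {a | ∃ b, ext a = {b}}

-- Through complements one can say that `a ∩ z`, `a \ z` and `z \ a` are all nonempty. A singleton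
-- `a` admits no such `z`. If `a` contains `u ≠ v` and misses `c`, then `z = {u, c}` works.
variable (M) in
theorem isSet_singles : IsSet (singles M) := by
  have hK := ((isRel_meet M).and ((isRel_meet M).not.comp (isRel_compl (M := M))).not).and
    (isSet_nontrivial (M := M)).box
  have := infinite_of_fiveModel M
  refine ((isSet_nontrivial (M := M)).sdiff hK.field).congr fun y => ?_
  constructor
  · rintro ⟨⟨⟨u, hu⟩, ⟨c, hc⟩⟩, hK⟩
    refine ⟨u, Set.eq_singleton_iff_unique_mem.2 ⟨hu, fun v hv => ?_⟩⟩
    by_contra hvu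
    obtain ⟨z, hz⟩ := isSet_pair u c
    have hvz : v ∉ ext z := by
      rw [hz]
      rintro (rfl | rfl)
      · exact hvu rfl
      · exact hc hv
    have huz : u ∈ ext z := by simp [hz]
    have hcz : c ∈ ext z := by simp [hz]
    refine hK ⟨z, ⟨⟨u, hu, huz⟩, ?_⟩, ⟨⟨u, hu⟩, ⟨c, hc⟩⟩, ⟨u, huz⟩, ⟨v, hvz⟩⟩
    rintro (⟨w, h, -, e⟩ | ⟨w, ⟨-, e⟩, h⟩)
    · refine h ⟨v, hv, ?_⟩
      by_contra hvw
      rw [e] at hvz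
      exact hvz hvw
    · exact h ⟨c, by rw [e]; exact hc, hcz⟩
  · rintro ⟨u, hu⟩
    obtain ⟨v, hv⟩ := exists_ne u
    refine ⟨⟨by simp [hu], ⟨v, by simpa [hu] using hv⟩⟩, ?_⟩
    rintro ⟨z, ⟨⟨x, hx, hxz⟩, h⟩, -, hz, hz'⟩
    obtain ⟨w, hw⟩ := IsSet.compl ⟨z, rfl⟩
    refine h (Or.inl ⟨w, ?_, ⟨hw ▸ hz', hz⟩, by rw [hw, compl_compl]⟩)
    rintro ⟨t, ht, htw⟩
    rw [hu] at ht hx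
    rw [hw] at htw
    exact htw (by rw [ht, ← hx]; exact hxz)

/-- The lift of a set relation to singletons. -/
theorem IsRel.lift {ρ : M → M → Prop} (hρ : IsRel ρ) :
    IsRel fun a a' => ∃ b b', ext a = {b} ∧ ext a' = {b'} ∧ ρ b b' := by
  have h1 := isSet_singles M
  have hP := hρ.isSet
  set P := {y : M | ∃ a b, ext y = {a, b} ∧ ρ a b} with hPdef
  -- For `b ≠ b'`, the singletons `{b}` and `{b'}` are linked through the two-element `r = {b, b'}`
  -- in `P`; the cross product forces the link to be no singleton. For `b = b'`, the singleton `{b}`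
  -- is itself the pair `{b, b}` and is tested by membership in `P`.
  have hS := (isRel_meet M).and (h1.cross (hP.sdiff h1) Set.disjoint_sdiff_right)
  refine (h1.box.and (((hS.comp hS).and (isRel_coext M).not).or
    ((isRel_coext M).and hP.box))).congr fun a a' => ?_
  have key : ∀ {x b}, ext x = {b} → (x ∈ P ↔ ρ b b) := by
    intro x b hx
    exact hρ.pair_iff (by simp [hx])
  constructor
  · rintro ⟨⟨⟨b, hb⟩, ⟨b', hb'⟩⟩, h⟩
    refine ⟨b, b', hb, hb', ?_⟩
    rcases h with ⟨h, hne⟩ | ⟨e, h, -⟩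
    · have hbb : b ≠ b' := by
        rintro rfl
        exact hne (hb.trans hb'.symm)
      have : ∃ r ∈ P, Meet a r ∧ Meet r a' := by
        have ha : a ∈ singles M := ⟨b, hb⟩
        rcases h with ⟨r, ⟨m, h⟩, m', -⟩ | ⟨r, ⟨m, h⟩, m', -⟩ <;>
        · rcases h with h | h
          · exact ⟨r, h.2.1, m, m'⟩
          · exact absurd ha h.1.2
      obtain ⟨r, hr, ⟨x, hx, hxr⟩, ⟨x', hxr', hx'⟩⟩ := this
      rw [hb] at hx
      rw [hb'] at hx'
      obtain rfl : x = b := hx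
      obtain rfl : x' = b' := hx'
      obtain ⟨c, d, e, hcd⟩ := hr
      rw [e] at hxr hxr'
      rcases hxr with rfl | rfl <;> rcases hxr' with rfl | rfl
      · exact absurd rfl hbb
      · exact hcd
      · exact hρ.symm _ _ hcd
      · exact absurd rfl hbb
    · have : b = b' := by
        rw [hb, hb'] at e
        simpa using e
      subst this
      exact (key hb).1 h
  · rintro ⟨b, b', hb, hb', h⟩
    refine ⟨⟨⟨b, hb⟩, ⟨b', hb'⟩⟩, ?_⟩
    by_cases hbb : b = b'
    · subst hbb
      exact Or.inr ⟨hb.trans hb'.symm, (key hb).2 h, (key hb').2 h⟩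
    · obtain ⟨r, hr⟩ := isSet_pair b b'
      have hrP : r ∈ P \ singles M := by
        refine ⟨⟨b, b', hr, h⟩, ?_⟩
        rintro ⟨c, hc⟩
        rw [hr] at hc
        have e1 : b ∈ ({c} : Set M) := hc ▸ Set.mem_insert _ _
        have e2 : b' ∈ ({c} : Set M) := hc ▸ Set.mem_insert_of_mem _ rfl
        exact hbb (e1.trans e2.symm)
      refine Or.inl ⟨Or.inl ⟨r, ⟨⟨b, by simp [hb], by simp [hr]⟩, Or.inl ⟨⟨b, hb⟩, hrP⟩⟩,
        ⟨b', by simp [hr], by simp [hb']⟩, Or.inr ⟨hrP, ⟨b', hb'⟩⟩⟩, ?_⟩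
      rw [hb, hb']
      simpa using hbb

end SetClosure

/-! ### Coding assignments by tagged iterated singletons. -/

section Coding

variable {M : Type*} [LSet.Structure M]

/-- `Lift d a u` says that `a` is a `d`-fold iterated singleton of `u`. -/
def Lift : ℕ → M → M → Prop
  | 0, a, u => a = u
  | d + 1, a, u => ∃ b, ext a = {b} ∧ Lift d b u

/-- The definition peels off the outermost singleton, this the innermost. It reduces equality `u =
w` to membership `u ∈ {w}`. -/
theorem Lift.exists_singleton {d : ℕ} {a u : M} (h : Lift (d + 1) a u) :
    ∃ w, Lift d a w ∧ ext w = {u} := by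
  induction d generalizing a with
  | zero =>
    obtain ⟨b, e, rfl⟩ := h
    exact ⟨a, rfl, e⟩
  | succ d ih =>
    obtain ⟨b, e, h⟩ := h
    obtain ⟨w, h, hw⟩ := ih h
    exact ⟨w, ⟨b, e, h⟩, hw⟩

theorem Lift.mem_singles {d : ℕ} {a u : M} (h : Lift (d + 1) a u) : a ∈ singles M :=
  let ⟨b, e, _⟩ := h
  ⟨b, e⟩

/-- Membership, lifted to iterated singletons. -/
def liftedMem : ℕ → M → M → Prop
  | 0 => Meet
  | d + 1 => fun a a' => ∃ b b', ext a = {b} ∧ ext a' = {b'} ∧ liftedMem d b b'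

/-- The base case is that `{u}` meets `w` iff `u ∈ w`. The extra singleton on the side of `u`
compensates for its type being lower by one. -/
theorem liftedMem_iff {d : ℕ} {a b u w : M} (ha : Lift (d + 1) a u) (hb : Lift d b w) :
    liftedMem d a b ↔ u ∈ ext w := by
  induction d generalizing a b with
  | zero =>
    obtain ⟨c, e, rfl⟩ := ha
    obtain rfl : b = w := hb
    simp [liftedMem, Meet, e]
  | succ d ih =>
    obtain ⟨a', ea, ha⟩ := ha
    obtain ⟨b', eb, hb⟩ := hb
    rw [← ih ha hb]
    simp [liftedMem, ea, eb]

/-- The unordered pairs of a singleton and the tag `t`. -/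
def slot (t : M) : Set M := {p | ∃ a ∈ singles M, ext p = {a, t}}

theorem pair_tag_inj {a a' t t' : M} (ha' : a' ∈ singles M)
    (ht : t ∉ singles M) (e : ({a, t} : Set M) = {a', t'}) : a = a' ∧ t = t' := by
  rcases Set.pair_eq_pair_iff.1 e with h | ⟨-, rfl⟩
  · exact h
  · exact absurd ha' ht

theorem slot_disjoint {t t' : M} (ht : t ∉ singles M) (h : t ≠ t') :
    Disjoint (slot t) (slot t') := by
  refine Set.disjoint_left.2 ?_
  rintro p ⟨a, ha, e⟩ ⟨a', ha', e'⟩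
  exact h (pair_tag_inj ha' ht (e.symm.trans e')).2

theorem slot_disjoint_singles {t : M} (ht : t ∉ singles M) : Disjoint (slot t) (singles M) := by
  refine Set.disjoint_left.2 ?_
  rintro p ⟨a, ha, e⟩ ⟨b, hb⟩
  rw [e] at hb
  have h1 : a ∈ ({b} : Set M) := hb ▸ Set.mem_insert _ _
  have h2 : t ∈ ({b} : Set M) := hb ▸ Set.mem_insert_of_mem _ rfl
  exact ht (Eq.trans h2 (Eq.symm h1) ▸ ha)

/-- In the slot with tag `t`, the object `s` has exactly one entry, which is a `d + 1`-fold
singleton of `u`. -/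
def SlotVal (t : M) (d : ℕ) (s u : M) : Prop :=
  ∃ a p, Lift (d + 1) a u ∧ ext p = {a, t} ∧ ext s ∩ slot t = {p}

theorem SlotVal.congr {t s s' u : M} {d : ℕ} (h : SlotVal t d s u)
    (e : ext s ∩ slot t = ext s' ∩ slot t) : SlotVal t d s' u := by
  obtain ⟨a, p, h1, h2, h3⟩ := h
  exact ⟨a, p, h1, h2, e ▸ h3⟩

theorem inter_slot_eq {t t' s s' : M} (ht : t ∉ singles M) (hne : t ≠ t')
    (e : ext s ∩ (slot t')ᶜ = ext s' ∩ (slot t')ᶜ) : ext s ∩ slot t = ext s' ∩ slot t := by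
  have h : (slot t')ᶜ ∩ slot t = slot t :=
    Set.inter_eq_right.2 (slot_disjoint ht hne).subset_compl_right
  rw [← h, ← Set.inter_assoc, ← Set.inter_assoc, e]

variable [FiveModel M]

theorem exists_lift (d : ℕ) (u : M) : ∃ a, Lift d a u := by
  induction d with
  | zero => exact ⟨u, rfl⟩
  | succ d ih =>
    obtain ⟨b, hb⟩ := ih
    obtain ⟨a, ha⟩ := isSet_singleton b
    exact ⟨a, b, ha, hb⟩

variable (M) in
theorem isSet_lifts (d : ℕ) : IsSet {a : M | ∃ u, Lift d a u} := by
  induction d with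
  | zero => exact (isSet_univ M).congr fun a => by simp [Lift]
  | succ d ih =>
    refine ((isSet_singles M).inter ih.powerset).congr fun a => ?_
    constructor
    · rintro ⟨⟨b, e⟩, h⟩
      obtain ⟨u, hu⟩ := h (by rw [e]; rfl : b ∈ ext a)
      exact ⟨u, b, e, hu⟩
    · rintro ⟨u, b, e, h⟩
      refine ⟨⟨b, e⟩, ?_⟩
      simpa [e] using Exists.intro u h

/-- A class is a set if its image under iterated singletons is. -/
theorem IsSet.of_lift {P : M → Prop} {d : ℕ} (h : IsSet {a | ∃ u, Lift d a u ∧ P u}) :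
    IsSet {u | P u} := by
  induction d with
  | zero => exact h.congr fun a => by simp [Lift]
  | succ d ih =>
    refine ih (h.sUnion.congr fun b => ?_)
    constructor
    · rintro ⟨a, ⟨u, ⟨b', e, h⟩, hP⟩, hb⟩
      rw [e] at hb
      obtain rfl : b = b' := hb
      exact ⟨u, h, hP⟩
    · rintro ⟨u, h, hP⟩
      obtain ⟨a, ha⟩ := isSet_singleton b
      exact ⟨a, ⟨u, ⟨b, ha, h⟩, hP⟩, by simp [ha]⟩

variable (M) in
theorem isRel_liftedMem (d : ℕ) : IsRel (liftedMem d : M → M → Prop) := by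
  induction d with
  | zero => exact isRel_meet M
  | succ d ih => exact ih.lift

theorem IsSet.isSet_pairs_with {A : Set M} (hA : IsSet A) {t : M} (ht : t ∉ A) :
    IsSet {p | ∃ a ∈ A, ext p = {a, t}} := by
  refine (hA.cross (isSet_singleton t) (Set.disjoint_singleton_right.2 ht)).isSet.congr
    fun p => ?_
  constructor
  · rintro ⟨a, b, e, ⟨ha, rfl⟩ | ⟨rfl, hb⟩⟩
    · exact ⟨a, ha, e⟩
    · exact ⟨b, hb, by rw [e, Set.pair_comm]⟩
  · rintro ⟨a, ha, e⟩
    exact ⟨a, t, e, Or.inl ⟨ha, rfl⟩⟩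

theorem isSet_slot {t : M} (ht : t ∉ singles M) : IsSet (slot t) :=
  (isSet_singles M).isSet_pairs_with ht

/-- An object has exactly one admissible entry iff it agrees on the slot with the singleton of such
an entry. -/
theorem isSet_slotVal {t : M} (ht : t ∉ singles M) (d : ℕ) :
    IsSet {s | ∃ u, SlotVal t d s u} := by
  have h : t ∉ {a : M | ∃ u, Lift (d + 1) a u} := fun ⟨u, hu⟩ => ht hu.mem_singles
  have hp := (isSet_lifts M (d + 1)).isSet_pairs_with h
  refine (((isSet_singles M).inter hp.powerset).saturate (isSet_slot ht)).congr fun s => ?_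
  constructor
  · rintro ⟨r, ⟨⟨p, hr⟩, hsub⟩, e⟩
    obtain ⟨a, ⟨u, hu⟩, hpa⟩ := hsub (by rw [hr]; rfl : p ∈ ext r)
    refine ⟨u, a, p, hu, hpa, ?_⟩
    rw [e, hr]
    exact Set.inter_eq_left.2 (Set.singleton_subset_iff.2 ⟨a, hu.mem_singles, hpa⟩)
  · rintro ⟨u, a, p, hu, hpa, e⟩
    obtain ⟨r, hr⟩ := isSet_singleton p
    refine ⟨r, ⟨⟨p, hr⟩, ?_⟩, ?_⟩
    · intro q hq
      rw [hr] at hq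
      obtain rfl : q = p := hq
      exact ⟨a, ⟨u, hu⟩, hpa⟩
    · rw [e, hr]
      exact (Set.inter_eq_left.2 (Set.singleton_subset_iff.2
        (show p ∈ slot t from ⟨a, hu.mem_singles, hpa⟩))).symm

/-- The relation between an entry of the slot with tag `t` and the singleton of its value. -/
theorem exists_tagRel {t : M} (ht : t ∉ singles M) : ∃ γ : M → M → Prop, IsRel γ ∧
    (∀ p x, γ p x → x ∈ singles M → ∃ a ∈ singles M, ext p = {a, t} ∧ ext x = {a}) ∧
    (∀ p x, γ p x → p ∈ singles M → x ∈ slot t) ∧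
    (∀ p x, γ p x → p ∈ singles M ∨ p ∈ slot t) ∧
    ∀ p x a, a ∈ singles M → ext p = {a, t} → ext x = {a} → γ p x := by
  have hd : Disjoint (slot t) (singles M ∩ {x | ext x ⊆ singles M}) :=
    (slot_disjoint_singles ht).mono_right Set.inter_subset_left
  have hn : ∀ p, p ∈ slot t → p ∉ singles M := fun p h k =>
    Set.disjoint_left.1 (slot_disjoint_singles ht) h k
  -- The relation is `Meet` between entries and singletons of singletons. If `{a, t}` meets `{c}`
  -- with `c` a singleton, then `c = a`, because `t` is not a singleton.
  refine ⟨_, ((isSet_slot ht).cross ((isSet_singles M).inter (isSet_singles M).powerset) hd).and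
    (isRel_meet M), ?_, ?_, ?_, ?_⟩
  · rintro p x ⟨⟨⟨a, ha, hp⟩, ⟨c, hc⟩, hx⟩ | h, m⟩ hx1
    · refine ⟨a, ha, hp, ?_⟩
      have hcs : c ∈ singles M := hx (by rw [hc]; rfl : c ∈ ext x)
      obtain ⟨y, hyp, hyx⟩ := m
      rw [hc] at hyx
      obtain rfl : y = c := hyx
      rw [hp] at hyp
      rcases hyp with rfl | rfl
      · exact hc
      · exact absurd hcs ht
    · exact absurd hx1 (hn x h.2)
  · rintro p x ⟨h | h, -⟩ hp
    · exact absurd hp (hn p h.1)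
    · exact h.2
  · rintro p x ⟨h | h, -⟩
    · exact Or.inr h.1
    · exact Or.inl h.1.1
  · intro p x a ha hp hx
    refine ⟨Or.inl ⟨⟨a, ha, hp⟩, ⟨a, hx⟩, ?_⟩, ⟨a, by simp [hp], by simp [hx]⟩⟩
    simpa [hx] using ha

/-- The pair is reached along the chain `{a, t}`, `{a}`, `{a'}`, `{a', t'}`, with the lift of `ρ` in
the middle. -/
theorem IsRel.isSet_tagged {ρ : M → M → Prop} (hρ : IsRel ρ) {t t' : M} (ht : t ∉ singles M)
    (ht' : t' ∉ singles M) (hne : t ≠ t') :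
    IsSet {q | ∃ p p' a a', ext q = {p, p'} ∧ (a ∈ singles M ∧ ext p = {a, t}) ∧
      (a' ∈ singles M ∧ ext p' = {a', t'}) ∧ ρ a a'} := by
  obtain ⟨γ, hγ, g1, g2, g3, g4⟩ := exists_tagRel ht
  obtain ⟨δ, hδ, d1, d2, d3, d4⟩ := exists_tagRel ht'
  have hX := hγ.comp hρ.lift
  have key : ∀ p p', (∃ b, ((∃ c, γ p c ∧ ∃ x x', ext c = {x} ∧ ext b = {x'} ∧ ρ x x') ∨
      (∃ c, (∃ x x', ext p = {x} ∧ ext c = {x'} ∧ ρ x x') ∧ γ c b)) ∧ δ b p') →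
      ∃ a a', (a ∈ singles M ∧ ext p = {a, t}) ∧ (a' ∈ singles M ∧ ext p' = {a', t'}) ∧
        ρ a a' := by
    rintro p p' ⟨b, ⟨c, h1, x, x', hc, hb, h⟩ | ⟨c, ⟨x, x', hp, hc, h⟩, h1⟩, h2⟩
    · obtain ⟨a, ha, hpa, hca⟩ := g1 _ _ h1 ⟨x, hc⟩
      obtain ⟨a', ha', hpa', hba'⟩ := d1 _ _ (hδ.symm _ _ h2) ⟨x', hb⟩
      rw [hc, Set.singleton_eq_singleton_iff] at hca
      rw [hb, Set.singleton_eq_singleton_iff] at hba'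
      subst hca hba'
      exact ⟨x, x', ⟨ha, hpa⟩, ⟨ha', hpa'⟩, h⟩
    -- The reversed composition would place `b` in the slot of `t`, while `δ` allows only singletons
    -- and entries of the slot of `t'`.
    · have hb := g2 _ _ h1 ⟨x', hc⟩
      rcases d3 _ _ h2 with k | k
      · exact absurd k (Set.disjoint_left.1 (slot_disjoint_singles ht) hb)
      · exact absurd k (Set.disjoint_left.1 (slot_disjoint ht hne) hb)
  refine (hX.comp hδ).isSet.congr fun q => ?_
  constructor
  · rintro ⟨p, p', e, h | ⟨b, h1, h2⟩⟩
    · obtain ⟨a, a', h⟩ := key _ _ h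
      exact ⟨p, p', a, a', e, h⟩
    · obtain ⟨a, a', h⟩ := key p' p ⟨b, hX.symm _ _ h2, hδ.symm _ _ h1⟩
      exact ⟨p', p, a, a', by rw [e, Set.pair_comm], h⟩
  · rintro ⟨p, p', a, a', e, ⟨ha, hp⟩, ⟨ha', hp'⟩, h⟩
    obtain ⟨c, hc⟩ := isSet_singleton a
    obtain ⟨b, hb⟩ := isSet_singleton a'
    exact ⟨p, p', e, Or.inl ⟨b, Or.inl ⟨c, g4 _ _ a ha hp hc, a, a', hc, hb, h⟩,
      hδ.symm _ _ (d4 _ _ a' ha' hp' hb)⟩⟩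

/-- A set relation between the values of two slots defines a set. -/
theorem IsRel.exists_slots {ρ : M → M → Prop} (hρ : IsRel ρ) {t t' : M} (ht : t ∉ singles M)
    (ht' : t' ∉ singles M) (hne : t ≠ t') :
    ∃ A, IsSet A ∧ ∀ s p p' a a', a ∈ singles M → a' ∈ singles M → ext p = {a, t} →
      ext p' = {a', t'} → ext s ∩ slot t = {p} → ext s ∩ slot t' = {p'} →
      (s ∈ A ↔ ρ a a') := by
  refine ⟨_, (hρ.isSet_tagged ht ht' hne).saturate ((isSet_slot ht).union (isSet_slot ht')), ?_⟩
  intro s p p' a a' ha ha' hp hp' hs hs'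
  have hB : ∀ {q p p' a a' : M}, a ∈ singles M → a' ∈ singles M → ext p = {a, t} →
      ext p' = {a', t'} → ext q = {p, p'} → ext q ∩ (slot t ∪ slot t') = {p, p'} := by
    intro q p p' a a' ha ha' hp hp' hq
    rw [hq]
    refine Set.inter_eq_left.2 (Set.insert_subset_iff.2 ⟨Or.inl ⟨a, ha, hp⟩, ?_⟩)
    exact Set.singleton_subset_iff.2 (Or.inr ⟨a', ha', hp'⟩)
  have hsB : ext s ∩ (slot t ∪ slot t') = {p, p'} := by
    rw [Set.inter_union_distrib_left, hs, hs']
    rfl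
  constructor
  · rintro ⟨q, ⟨p₁, p₁', a₁, a₁', hq, ⟨h1, h2⟩, ⟨h3, h4⟩, h⟩, e⟩
    rw [hsB, hB h1 h3 h2 h4 hq, Set.pair_eq_pair_iff] at e
    rcases e with ⟨rfl, rfl⟩ | ⟨rfl, rfl⟩
    · obtain ⟨rfl, -⟩ := pair_tag_inj h1 ht (hp.symm.trans h2)
      obtain ⟨rfl, -⟩ := pair_tag_inj h3 ht' (hp'.symm.trans h4)
      exact h
    · exact absurd (pair_tag_inj h3 ht (hp.symm.trans h4)).2 hne
  · intro h
    obtain ⟨q, hq⟩ := isSet_pair p p'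
    exact ⟨q, ⟨p, p', a, a', hq, ⟨ha, hp⟩, ⟨ha', hp'⟩, h⟩,
      hsB.trans (hB ha ha' hp hp' hq).symm⟩

theorem exists_slots_mem {t t' : M} (ht : t ∉ singles M) (ht' : t' ∉ singles M) (hne : t ≠ t')
    (d : ℕ) : ∃ A, IsSet A ∧ ∀ s u w, SlotVal t (d + 1) s u → SlotVal t' d s w →
      (s ∈ A ↔ u ∈ ext w) := by
  obtain ⟨A, hA, h⟩ := (isRel_liftedMem M (d + 1)).exists_slots ht ht' hne
  refine ⟨A, hA, ?_⟩
  rintro s u w ⟨a, p, hu, hp, hs⟩ ⟨b, q, hw, hq, hs'⟩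
  rw [h s p q a b hu.mem_singles hw.mem_singles hp hq hs hs', liftedMem_iff hu hw]

theorem exists_slots_eq {t t' : M} (ht : t ∉ singles M) (ht' : t' ∉ singles M) (hne : t ≠ t')
    (d : ℕ) : ∃ A, IsSet A ∧ ∀ s u w, SlotVal t d s u → SlotVal t' d s w →
      (s ∈ A ↔ u = w) := by
  obtain ⟨A, hA, h⟩ := (isRel_liftedMem M d).exists_slots ht ht' hne
  refine ⟨A, hA, ?_⟩
  rintro s u w ⟨a, p, hu, hp, hs⟩ ⟨b, q, hw, hq, hs'⟩
  obtain ⟨w', hw', e⟩ := hw.exists_singleton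
  rw [h s p q a b hu.mem_singles hw.mem_singles hp hq hs hs', liftedMem_iff hu hw', e,
    Set.mem_singleton_iff]

-- Complements of singletons serve as tags; they are not singletons because the structure is
-- infinite.
variable (M) in
theorem exists_tags (ι : Type*) [Countable ι] :
    ∃ t : ι → M, Function.Injective t ∧ ∀ i, t i ∉ singles M := by
  have := infinite_of_fiveModel M
  obtain ⟨f, hf⟩ := Countable.exists_injective_nat ι
  choose g hg using fun a : M => (isSet_singleton a).compl
  refine ⟨fun i => g (Infinite.natEmbedding M (f i)), ?_, ?_⟩
  · refine Function.Injective.comp (g := fun n => g (Infinite.natEmbedding M n)) ?_ hf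
    refine Function.Injective.comp (g := g) (fun a b h => ?_) (Infinite.natEmbedding M).injective
    have := (hg a).symm.trans ((congrArg ext h).trans (hg b))
    simpa using this
  · rintro i ⟨b, hb⟩
    rw [hg] at hb
    have : (Set.univ : Set M) ⊆ {Infinite.natEmbedding M (f i), b} := by
      intro x _
      by_cases hx : x = Infinite.natEmbedding M (f i)
      · exact Or.inl hx
      · have hx' : x ∈ ({Infinite.natEmbedding M (f i)} : Set M)ᶜ := hx
        rw [hb] at hx'
        exact Or.inr hx'
    exact Set.infinite_univ ((Set.toFinite _).subset this)

end Coding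

/-! ### Stratified formulas define sets of codes, hence sets. -/

section Comprehension

variable {M : Type*} [LSet.Structure M] {α : Type} {m : ℕ}

/-- The object `s` codes the values `v`, `w` of the variables with types `σ`, `τ`; the slot
of each variable is given by its tag. -/
def Codes (t : α ⊕ ℕ → M) (T : ℕ) (σ : α → ℕ) (τ : Fin m → ℕ) (s : M) (v : α → M)
    (w : Fin m → M) : Prop :=
  ∀ x : α ⊕ Fin m, SlotVal (t (x.map id Fin.val)) (T - Sum.elim σ τ x) s (Sum.elim v w x)

theorem codes_snoc_iff {t : α ⊕ ℕ → M} {T : ℕ} {σ : α → ℕ} {τ : Fin m → ℕ} {k : ℕ} {s : M}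
    {v : α → M} {w : Fin m → M} {u : M} :
    Codes t T σ (Fin.snoc τ k : Fin (m + 1) → ℕ) s v (Fin.snoc w u : Fin (m + 1) → M) ↔
      Codes t T σ τ s v w ∧ SlotVal (t (.inr m)) (T - k) s u := by
  simp [Codes, Sum.forall, Fin.forall_fin_succ', and_assoc]

/-- The slot `inr m` belongs to the next quantified variable, so its content does not affect the
current ones. -/
theorem Codes.congr {t : α ⊕ ℕ → M} (ti : Function.Injective t) (tn : ∀ i, t i ∉ singles M)
    {T : ℕ} {σ : α → ℕ} {τ : Fin m → ℕ} {s s' : M} {v : α → M} {w : Fin m → M}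
    (h : Codes t T σ τ s v w)
    (e : ext s ∩ (slot (t (.inr m)))ᶜ = ext s' ∩ (slot (t (.inr m)))ᶜ) :
    Codes t T σ τ s' v w := by
  intro x
  refine (h x).congr (inter_slot_eq (tn _) (fun h => ?_) e)
  have := ti h
  rcases x with x | x
  · simp at this
  · have hx := x.2
    simp at this
    omega

variable [FiveModel M]

theorem exists_slotVal_update {t : M} (ht : t ∉ singles M) {d : ℕ} (s : M) {a u : M}
    (ha : Lift (d + 1) a u) : ∃ s', ext s' ∩ (slot t)ᶜ = ext s ∩ (slot t)ᶜ ∧ SlotVal t d s' u ∧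
      ∃ p ∈ ext s' ∩ slot t, a ∈ ext p := by
  obtain ⟨p, hp⟩ := isSet_pair a t
  have hps : p ∈ slot t := ⟨a, ha.mem_singles, hp⟩
  obtain ⟨s', hs'⟩ := ((IsSet.inter ⟨s, rfl⟩ (isSet_slot ht).compl).union (isSet_singleton p))
  refine ⟨s', ?_, ⟨a, p, ha, hp, ?_⟩, p, ⟨by simp [hs'], hps⟩, by simp [hp]⟩
  · rw [hs']
    ext x
    simp only [Set.mem_inter_iff, Set.mem_union, Set.mem_compl_iff, Set.mem_singleton_iff]
    constructor
    · rintro ⟨h | rfl, k⟩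
      · exact h
      · exact absurd hps k
    · exact fun h => ⟨Or.inl h, h.2⟩
  · rw [hs']
    ext x
    simp only [Set.mem_inter_iff, Set.mem_union, Set.mem_compl_iff, Set.mem_singleton_iff]
    constructor
    · rintro ⟨h | rfl, k⟩
      · exact absurd k h.2
      · rfl
    · rintro rfl
      exact ⟨Or.inr rfl, hps⟩

/-- A stratified formula defines a set of codes of assignments. -/
theorem exists_isSet_codes {t : α ⊕ ℕ → M} (ti : Function.Injective t)
    (tn : ∀ i, t i ∉ singles M) (σ : α → ℕ) (φ : LSet.BoundedFormula α m) :
    ∀ τ : Fin m → ℕ, StratifiedBy σ τ φ → ∃ T₀, ∀ T ≥ T₀, ∃ A, IsSet A ∧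
      ∀ s v w, Codes t T σ τ s v w → (s ∈ A ↔ φ.Realize v w) := by
  have inj : ∀ {m : ℕ} {x y : α ⊕ Fin m}, x ≠ y →
      t (x.map id Fin.val) ≠ t (y.map id Fin.val) := by
    intro m x y h e
    exact h (Function.Injective.sumMap Function.injective_id Fin.val_injective (ti e))
  induction φ with
  | falsum => exact fun τ _ => ⟨0, fun T _ => ⟨∅, isSet_empty M, fun s v w _ => Iff.rfl⟩⟩
  | equal t₁ t₂ =>
    intro τ h
    rcases t₁ with x | f
    swap
    · exact Empty.elim f
    rcases t₂ with y | f
    swap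
    · exact Empty.elim f
    -- Equal types give equal differences from `T`, even truncated, so no bound on `T` is needed.
    refine ⟨0, fun T _ => ?_⟩
    by_cases hxy : x = y
    · subst hxy
      exact ⟨Set.univ, isSet_univ M, fun s v w _ => iff_of_true trivial rfl⟩
    · obtain ⟨A, hA, h'⟩ := exists_slots_eq (tn _) (tn _) (inj hxy) (T - Sum.elim σ τ x)
      refine ⟨A, hA, fun s v w hs => h' s _ _ (hs x) ?_⟩
      have h1 : Sum.elim σ τ x = Sum.elim σ τ y := h
      rw [h1]
      exact hs y
  | rel R ts =>
    intro τ h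
    cases R
    rcases h0 : ts 0 with x | f
    swap
    · exact Empty.elim f
    rcases h1 : ts 1 with y | f
    swap
    · exact Empty.elim f
    have h : Sum.elim σ τ y = Sum.elim σ τ x + 1 := by
      have h2 : termType σ τ (ts 1) = termType σ τ (ts 0) + 1 := h
      rw [h0, h1] at h2
      exact h2
    have hxy : x ≠ y := by
      rintro rfl
      omega
    -- Here `T` must reach the type of `y`; otherwise truncated subtraction loses the difference of
    -- one.
    refine ⟨Sum.elim σ τ y, fun T hT => ?_⟩
    obtain ⟨A, hA, h'⟩ := exists_slots_mem (tn _) (tn _) (inj hxy) (T - Sum.elim σ τ y)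
    refine ⟨A, hA, fun s v w hs => ?_⟩
    rw [h' s _ _ (by rw [show T - Sum.elim σ τ y + 1 = T - Sum.elim σ τ x by omega]; exact hs x)
      (hs y), mem_ext]
    refine iff_of_eq (congrArg (Structure.RelMap memSymb) ?_)
    funext i
    fin_cases i
    · exact (congrArg (Term.realize (Sum.elim v w)) h0).symm
    · exact (congrArg (Term.realize (Sum.elim v w)) h1).symm
  | imp φ ψ ih₁ ih₂ =>
    rintro τ ⟨h₁, h₂⟩
    obtain ⟨T₁, H₁⟩ := ih₁ τ h₁
    obtain ⟨T₂, H₂⟩ := ih₂ τ h₂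
    refine ⟨max T₁ T₂, fun T hT => ?_⟩
    obtain ⟨A, hA, H₁⟩ := H₁ T (le_trans (le_max_left _ _) hT)
    obtain ⟨B, hB, H₂⟩ := H₂ T (le_trans (le_max_right _ _) hT)
    refine ⟨Aᶜ ∪ B, hA.compl.union hB, fun s v w hs => ?_⟩
    rw [BoundedFormula.realize_imp, ← H₁ s v w hs, ← H₂ s v w hs, imp_iff_not_or]
    rfl
  | @all n φ ih =>
    rintro τ ⟨k, h⟩
    obtain ⟨T₀, H⟩ := ih _ h
    refine ⟨T₀, fun T hT => ?_⟩
    obtain ⟨A, hA, H⟩ := H T hT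
    have ht := tn (.inr n)
    -- A counterexample is a code outside `A` that agrees with `s` off the slot of the bound
    -- variable and has a genuine value in it.
    refine ⟨_, ((hA.compl.inter (isSet_slotVal ht (T - k))).saturate (isSet_slot ht).compl).compl,
      fun s v w hs => ?_⟩
    rw [BoundedFormula.realize_all, Set.mem_compl_iff, not_iff_comm, not_forall]
    constructor
    · rintro ⟨u, hu⟩
      obtain ⟨a, ha⟩ := exists_lift (T - k + 1) u
      obtain ⟨s', e, hs', -⟩ := exists_slotVal_update ht s ha
      have hc := codes_snoc_iff.2 ⟨hs.congr ti tn e.symm, hs'⟩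
      exact ⟨s', ⟨fun h' => hu ((H _ _ _ hc).1 h'), u, hs'⟩, e.symm⟩
    · rintro ⟨s', ⟨hs', u, hu⟩, e⟩
      have hc := codes_snoc_iff.2 ⟨hs.congr ti tn e, hu⟩
      exact ⟨u, fun h' => hs' ((H _ _ _ hc).2 h')⟩

theorem exists_codes {n : ℕ} {t : Fin n → M} (ti : Function.Injective t)
    (tn : ∀ i, t i ∉ singles M) (d : Fin n → ℕ) (v : Fin n → M) :
    ∃ s, ∀ i, SlotVal (t i) (d i) s (v i) := by
  choose a ha using fun i => exists_lift (d i + 1) (v i)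
  choose p hp using fun i => isSet_pair (a i) (t i)
  obtain ⟨s, hs⟩ := isSet_range p
  refine ⟨s, fun i => ⟨a i, p i, ha i, hp i, ?_⟩⟩
  rw [hs]
  ext x
  constructor
  · rintro ⟨⟨j, rfl⟩, b, hb, hj⟩
    have := pair_tag_inj hb (tn j) ((hp j).symm.trans hj)
    rw [ti this.2]
    rfl
  · rintro rfl
    exact ⟨⟨i, rfl⟩, a i, (ha i).mem_singles, hp i⟩

theorem isSet_of_stratified {n : ℕ} {φ : LSet.Formula (Fin (n + 1))} (hφ : Stratified φ)
    (v : Fin n → M) : IsSet {y | φ.Realize (Fin.snoc v y : Fin (n + 1) → M)} := by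
  obtain ⟨σ, hσ⟩ := hφ
  obtain ⟨t, ti, tn⟩ := exists_tags M (Fin (n + 1) ⊕ ℕ)
  obtain ⟨T, H⟩ := exists_isSet_codes ti tn σ φ _ hσ
  obtain ⟨A, hA, H⟩ := H T le_rfl
  have codes_iff : ∀ (s y : M), Codes t T σ (Fin.elim0 : Fin 0 → ℕ) s
      (Fin.snoc v y : Fin (n + 1) → M) default ↔
      (∀ i : Fin n, SlotVal (t (.inl i.castSucc)) (T - σ i.castSucc) s (v i)) ∧
        SlotVal (t (.inl (Fin.last n))) (T - σ (Fin.last n)) s y := by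
    intro s y
    simp [Codes, Sum.forall, Fin.forall_fin_succ']
  set l := t (.inl (Fin.last n))
  set D := T - σ (Fin.last n)
  have hl : l ∉ singles M := tn _
  obtain ⟨s₀, hs₀⟩ := exists_codes (t := fun i : Fin n => t (.inl i.castSucc))
    (fun i j h => by simpa using ti h) (fun i => tn _) (fun i => T - σ i.castSucc) v
  -- Agreement with `s₀` off the slot of `y` fixes the parameters, so these are codes of solutions
  -- `y`.
  have hS := (hA.inter (isSet_slotVal hl D)).inter
    ((isSet_singleton s₀).saturate (isSet_slot hl).compl)
  -- One union yields the entries `{a, l}`, a second yields each `a` together with `l`. Intersecting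
  -- with the iterated singletons removes `l`, and `IsSet.of_lift` returns from `a` to `y`.
  refine IsSet.of_lift (d := D + 1) ((((hS.sUnion.inter (isSet_slot hl)).sUnion).inter
    (isSet_lifts M (D + 1))).congr fun a => ?_)
  have hne : ∀ i : Fin n, t (.inl i.castSucc) ≠ l := fun i h => by
    have := ti h
    simp at this
  constructor
  · rintro ⟨⟨p, ⟨⟨s, ⟨⟨hsA, u, hu⟩, _, rfl, e⟩, hps⟩, hpl⟩, hap⟩, u', hu'⟩
    have hc := (codes_iff s u).2
      ⟨fun i => (hs₀ i).congr (inter_slot_eq (tn _) (hne i) e.symm), hu⟩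
    have hr := (H _ _ _ hc).1 hsA
    obtain ⟨b, q, hb, hq, e'⟩ := hu
    have hpq : p ∈ ({q} : Set M) := e' ▸ ⟨hps, hpl⟩
    obtain rfl : p = q := hpq
    rw [hq] at hap
    rcases hap with rfl | rfl
    · exact ⟨u, hb, hr⟩
    · exact absurd hu'.mem_singles hl
  · rintro ⟨u, ha, hr⟩
    obtain ⟨s, e, hs, p, ⟨hps, hpl⟩, hap⟩ := exists_slotVal_update hl s₀ ha
    have hc := (codes_iff s u).2
      ⟨fun i => (hs₀ i).congr (inter_slot_eq (tn _) (hne i) e.symm), hs⟩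
    exact ⟨⟨p, ⟨⟨s, ⟨⟨(H _ _ _ hc).2 hr, u, hs⟩, s₀, rfl, e⟩, hps⟩, hpl⟩, hap⟩, u, ha⟩

end Comprehension

/-! ### Stratification and realization of the formulas behind the axioms. -/

section Formulas

variable {α : Type} {n : ℕ}

/-- The formula `x ∈ y`, for free or bound variables `x`, `y`. -/
def memV (x y : α ⊕ Fin n) : LSet.BoundedFormula α n :=
  .rel memSymb ![.var x, .var y]

/-- The formula `x = y`, for free or bound variables `x`, `y`. -/
def eqV (x y : α ⊕ Fin n) : LSet.BoundedFormula α n :=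
  .equal (.var x) (.var y)

/-- The formula `pair(x, a, b)`, for free or bound variables `x`, `a`, `b`. -/
def pairV (x a b : α ⊕ Fin n) : LSet.BoundedFormula α n :=
  ∀' (memV (.inr (Fin.last n)) (x.map id Fin.castSucc) ⇔
    (eqV (.inr (Fin.last n)) (a.map id Fin.castSucc) ⊔
      eqV (.inr (Fin.last n)) (b.map id Fin.castSucc)))

variable {σ : α → ℕ} {τ : Fin n → ℕ}

theorem stratifiedBy_memV {x y : α ⊕ Fin n} :
    StratifiedBy σ τ (memV x y) ↔ Sum.elim σ τ y = Sum.elim σ τ x + 1 := Iff.rfl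

theorem stratifiedBy_eqV {x y : α ⊕ Fin n} :
    StratifiedBy σ τ (eqV x y) ↔ Sum.elim σ τ x = Sum.elim σ τ y := Iff.rfl

theorem stratifiedBy_not {φ : LSet.BoundedFormula α n} :
    StratifiedBy σ τ (∼φ) ↔ StratifiedBy σ τ φ :=
  iff_of_eq (and_true _)

theorem stratifiedBy_inf {φ ψ : LSet.BoundedFormula α n} :
    StratifiedBy σ τ (φ ⊓ ψ) ↔ StratifiedBy σ τ φ ∧ StratifiedBy σ τ ψ := by
  change ((StratifiedBy σ τ φ ∧ StratifiedBy σ τ ψ ∧ True) ∧ True) ↔ _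
  simp

theorem stratifiedBy_sup {φ ψ : LSet.BoundedFormula α n} :
    StratifiedBy σ τ (φ ⊔ ψ) ↔ StratifiedBy σ τ φ ∧ StratifiedBy σ τ ψ := by
  change ((StratifiedBy σ τ φ ∧ True) ∧ StratifiedBy σ τ ψ) ↔ _
  simp

theorem stratifiedBy_iff {φ ψ : LSet.BoundedFormula α n} :
    StratifiedBy σ τ (φ ⇔ ψ) ↔ StratifiedBy σ τ φ ∧ StratifiedBy σ τ ψ := by
  refine Iff.trans stratifiedBy_inf ?_
  change (StratifiedBy σ τ φ ∧ StratifiedBy σ τ ψ) ∧ (StratifiedBy σ τ ψ ∧ StratifiedBy σ τ φ) ↔ _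
  tauto

theorem stratifiedBy_all {φ : LSet.BoundedFormula α (n + 1)} :
    StratifiedBy σ τ (∀' φ) ↔ ∃ k, StratifiedBy σ (Fin.snoc τ k : Fin (n + 1) → ℕ) φ := Iff.rfl

theorem stratifiedBy_ex {φ : LSet.BoundedFormula α (n + 1)} :
    StratifiedBy σ τ (∃' φ) ↔ ∃ k, StratifiedBy σ (Fin.snoc τ k : Fin (n + 1) → ℕ) φ := by
  refine Iff.trans stratifiedBy_not (exists_congr fun k => stratifiedBy_not)

theorem elim_snoc_map {β : Type*} (f : α → β) (g : Fin n → β) (b : β) (x : α ⊕ Fin n) :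
    Sum.elim f (Fin.snoc g b : Fin (n + 1) → β) (x.map id Fin.castSucc) = Sum.elim f g x := by
  cases x <;> simp

theorem stratifiedBy_pairV {x a b : α ⊕ Fin n} :
    StratifiedBy σ τ (pairV x a b) ↔ Sum.elim σ τ x = Sum.elim σ τ a + 1 ∧
      Sum.elim σ τ a = Sum.elim σ τ b := by
  simp only [pairV, stratifiedBy_all, stratifiedBy_iff, stratifiedBy_sup, stratifiedBy_memV,
    stratifiedBy_eqV, elim_snoc_map, Sum.elim_inr, Fin.snoc_last]
  constructor
  · rintro ⟨k, h, rfl, h'⟩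
    exact ⟨h, h'⟩
  · rintro ⟨h, h'⟩
    exact ⟨_, h, rfl, h'⟩

variable {M : Type*} [LSet.Structure M] {v : α → M} {w : Fin n → M}

theorem realize_memV {x y : α ⊕ Fin n} :
    (memV x y).Realize v w ↔ E (Sum.elim v w x) (Sum.elim v w y) := by
  refine iff_of_eq (congrArg (Structure.RelMap memSymb) ?_)
  funext i
  fin_cases i <;> rfl

theorem realize_eqV {x y : α ⊕ Fin n} :
    (eqV x y).Realize v w ↔ Sum.elim v w x = Sum.elim v w y := Iff.rfl

theorem realize_pairV {x a b : α ⊕ Fin n} :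
    (pairV x a b).Realize v w ↔
      IsPair (Sum.elim v w x) (Sum.elim v w a) (Sum.elim v w b) := by
  simp only [pairV, BoundedFormula.realize_all, BoundedFormula.realize_iff,
    BoundedFormula.realize_sup, realize_memV, realize_eqV, elim_snoc_map, Sum.elim_inr,
    Fin.snoc_last, IsPair]

end Formulas

/-! ### Equivalence of the two theories on structures. -/

section Axioms

variable {M : Type*} [LSet.Structure M]

theorem comprehension_of_model (h : M ⊨ SF) {n : ℕ} {φ : LSet.Formula (Fin (n + 1))}
    (hφ : Stratified φ) (p : Fin n → M) :
    ∃ X : M, ∀ y : M, E y X ↔ φ.Realize (Fin.snoc p y : Fin (n + 1) → M) :=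
  (realize_comprehension φ).1 (h.realize_of_mem _ ⟨n, φ, hφ, rfl⟩) p

theorem model_shefferStrokes (h : M ⊨ SF) : M ⊨ shefferStrokes := by
  refine realize_shefferStrokes.2 fun A B => ?_
  have hφ : Stratified (∼(memV (.inl 2) (.inl 0) ⊓ memV (.inl 2) (.inl 1)) :
      LSet.BoundedFormula (Fin 3) 0) := by
    refine ⟨![1, 1, 0], ?_⟩
    simp [stratifiedBy_not, stratifiedBy_inf, stratifiedBy_memV]
  simpa [Formula.Realize, realize_memV, Fin.snoc] using comprehension_of_model h hφ ![A, B]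

theorem model_singletons (h : M ⊨ SF) : M ⊨ singletons := by
  refine realize_singletons.2 fun A => ?_
  have hφ : Stratified (eqV (.inl 1) (.inl 0) : LSet.BoundedFormula (Fin 2) 0) :=
    ⟨fun _ => 0, rfl⟩
  simpa [Formula.Realize, realize_eqV, Fin.snoc] using comprehension_of_model h hφ ![A]

theorem model_setUnions (h : M ⊨ SF) : M ⊨ setUnions := by
  refine realize_setUnions.2 fun A => ?_
  have hφ : Stratified (∃' (memV (.inr 0) (.inl 0) ⊓ memV (.inl 1) (.inr 0)) :
      LSet.BoundedFormula (Fin 2) 0) := by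
    refine ⟨![2, 0], ?_⟩
    simp only [stratifiedBy_ex, stratifiedBy_inf, stratifiedBy_memV]
    exact ⟨1, rfl, rfl⟩
  simpa [Formula.Realize, realize_memV, Fin.snoc] using comprehension_of_model h hφ ![A]

theorem model_unorderedRelativeProducts (h : M ⊨ SF) : M ⊨ unorderedRelativeProducts := by
  refine realize_unorderedRelativeProducts.2 fun R S => ?_
  have hφ : Stratified (∃' ∃' ∃' ∃' ∃' (pairV (.inl 2) (.inr 0) (.inr 2) ⊓
      (memV (.inr 3) (.inl 0) ⊓ (memV (.inr 4) (.inl 1) ⊓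
        (pairV (.inr 3) (.inr 0) (.inr 1) ⊓ pairV (.inr 4) (.inr 1) (.inr 2))))) :
      LSet.BoundedFormula (Fin 3) 0) := by
    refine ⟨![2, 2, 1], ?_⟩
    simp only [stratifiedBy_ex, stratifiedBy_inf, stratifiedBy_memV, stratifiedBy_pairV]
    exact ⟨0, 0, 0, 1, 1, ⟨rfl, rfl⟩, rfl, rfl, ⟨rfl, rfl⟩, rfl, rfl⟩
  simpa [Formula.Realize, realize_memV, realize_pairV, Fin.snoc] using
    comprehension_of_model h hφ ![R, S]

theorem model_unorderedIntersectionRelation (h : M ⊨ SF) :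
    M ⊨ unorderedIntersectionRelation := by
  refine realize_unorderedIntersectionRelation.2 ?_
  have hφ : Stratified (∃' ∃' ∃' (pairV (.inl 0) (.inr 0) (.inr 1) ⊓
      (memV (.inr 2) (.inr 0) ⊓ memV (.inr 2) (.inr 1))) : LSet.BoundedFormula (Fin 1) 0) := by
    refine ⟨![2], ?_⟩
    simp only [stratifiedBy_ex, stratifiedBy_inf, stratifiedBy_memV, stratifiedBy_pairV]
    exact ⟨1, 1, 0, ⟨rfl, rfl⟩, rfl, rfl⟩
  simpa [Formula.Realize, realize_memV, realize_pairV, Fin.snoc] using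
    comprehension_of_model h hφ ![]

theorem fiveModel_of_model (h : M ⊨ fiveAxioms) : FiveModel M where
  sheffer A B := isSet_iff.2
    (realize_shefferStrokes.1 (h.realize_of_mem _ (by simp [fiveAxioms])) A B)
  singleton A := isSet_iff.2
    (realize_singletons.1 (h.realize_of_mem _ (by simp [fiveAxioms])) A)
  sUnion A := isSet_iff.2
    (realize_setUnions.1 (h.realize_of_mem _ (by simp [fiveAxioms])) A)
  product R S := by
    obtain ⟨X, hX⟩ := realize_unorderedRelativeProducts.1
      (h.realize_of_mem _ (by simp [fiveAxioms])) R S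
    refine isSet_iff.2 ⟨X, fun y => (hX y).trans ?_⟩
    simp only [isPair_iff, mem_ext]
    constructor
    · rintro ⟨a, b, c, r, s, h1, h2, h3, h4, h5⟩
      exact ⟨a, b, c, h1, ⟨r, h2, h4⟩, s, h3, h5⟩
    · rintro ⟨a, b, c, h1, ⟨r, h2, h4⟩, s, h3, h5⟩
      exact ⟨a, b, c, r, s, h1, h2, h3, h4, h5⟩
  inter := by
    obtain ⟨X, hX⟩ := realize_unorderedIntersectionRelation.1
      (h.realize_of_mem _ (by simp [fiveAxioms]))
    refine isSet_iff.2 ⟨X, fun y => (hX y).trans ?_⟩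
    simp [isPair_iff, Set.Nonempty, mem_ext]

theorem model_SF_iff : M ⊨ SF ↔ M ⊨ fiveAxioms := by
  constructor
  · intro h
    refine ⟨fun ψ hψ => ?_⟩
    simp only [fiveAxioms, Set.mem_insert_iff, Set.mem_singleton_iff] at hψ
    rcases hψ with rfl | rfl | rfl | rfl | rfl
    · exact model_shefferStrokes h
    · exact model_singletons h
    · exact model_setUnions h
    · exact model_unorderedRelativeProducts h
    · exact model_unorderedIntersectionRelation h
  · intro h
    have := fiveModel_of_model h
    refine ⟨?_⟩
    rintro _ ⟨n, φ, hφ, rfl⟩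
    exact (realize_comprehension φ).2 fun p => isSet_iff.1 (isSet_of_stratified hφ p)

end Axioms

end SetTheorySF

theorem mainTheorem1 :
    SetTheorySF.fiveAxioms.Finite ∧
    (∀ (M : Type*) [SetTheorySF.LSet.Structure M],
      M ⊨ SetTheorySF.SF ↔ M ⊨ SetTheorySF.fiveAxioms) ∧
    (∀ ψ : SetTheorySF.LSet.Sentence,
      SetTheorySF.SF ⊨ᵇ ψ ↔ SetTheorySF.fiveAxioms ⊨ᵇ ψ) := by
  refine ⟨by simp [SetTheorySF.fiveAxioms], fun M _ => SetTheorySF.model_SF_iff, fun ψ => ?_⟩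
  simp only [Theory.models_sentence_iff]
  constructor
  · intro h N
    have : N ⊨ SetTheorySF.SF := SetTheorySF.model_SF_iff.2 N.is_model
    exact h (Theory.ModelType.of SetTheorySF.SF N)
  · intro h N
    have : N ⊨ SetTheorySF.fiveAxioms := SetTheorySF.model_SF_iff.1 N.is_model
    exact h (Theory.ModelType.of SetTheorySF.fiveAxioms N)
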